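/- Let $n\ge 2$ and $q=2^n$, let $F$ be a field of characteristic $2$, and let $a\in F$ be nonzero. Put $T(x)=\sum_{i=0}^{n-1}x^{2^i-1}$ and $C(x)=x\,T(x)^{q+1}$. Let $L$ be the splitting field of $x^{q+1}+x+1/a$ over $F$. Then $L$ is also the splitting field of $C(x)+a$ over $F$, and $L$ contains the field $\mathbb F_q$ with $q$ elements. Let $F\cdot\mathbb F_q\subseteq L$ be the compositum of $F$ and $\mathbb F_q$, and let $\sigma\in\operatorname{Gal}(L/F\cdot\mathbb F_q)$; $\sigma$-orbits are orbits of the cyclic group generated by $\sigma$. (i) If $\sigma$ fixes at least three roots of $x^{q+1}+x+1/a$, then it fixes all roots of $x^{q+1}+x+1/a$ and all roots of $C(x)+a$. (ii) If $\sigma$ fixes exactly two roots of $x^{q+1}+x+1/a$, then there is a divisor $\delta$ of $q-1$ such that the $\sigma$-orbits on the roots of $x^{q+1}+x+1/a$ have sizes $[1,1,\delta,\delta,\ldots,\delta]$ and all $\sigma$-orbits on the roots of $C(x)+a$ have size $\delta$. (iii) If $\sigma$ fixes exactly one root of $x^{q+1}+x+1/a$, then the remaining roots of $x^{q+1}+x+1/a$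 fall into $\sigma$-orbits of size $2$. Also, $\sigma$ fixes exactly $q/2$ roots of $C(x)+a$, and the remaining roots of $C(x)+a$ fall into exactly $\frac q2\left(\frac q2-1\right)$ $\sigma$-orbits of size $2$. (iv) If $\sigma$ fixes no root of $x^{q+1}+x+1/a$, then there is a divisor $\delta$ of $q+1$ such that all $\sigma$-orbits on the roots of $x^{q+1}+x+1/a$ have size $\delta$; moreover, $\sigma$ fixes exactly one root of $C(x)+a$, and all remaining roots of $C(x)+a$ belong to $\sigma$-orbits of size $\delta$. -/

import Mathlib

open Polynomial

namespace MCM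

/-- `T(x) = ∑_{i=0}^{n-1} x^{2^i - 1}`. -/
noncomputable def T (F : Type*) [Field F] (n : ℕ) : F[X] :=
  ∑ i ∈ Finset.range n, X ^ (2 ^ i - 1)

/-- The Müller–Cohen–Matthews polynomial `C(x) = x T(x)^{q+1}`, where `q = 2^n`. -/
noncomputable def mcm (F : Type*) [Field F] (n : ℕ) : F[X] :=
  X * T F n ^ (2 ^ n + 1)

/-- `C(x) + a`. -/
noncomputable def mcmAdd {F : Type*} [Field F] (n : ℕ) (a : F) : F[X] :=
  mcm F n + C a

/-- `x^{q+1} + x + 1/a`, where `q = 2^n`. -/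
noncomputable def trinomial {F : Type*} [Field F] (n : ℕ) (a : F) : F[X] :=
  X ^ (2 ^ n + 1) + X + C (1 / a)

/-- The elements `t` of `L` with `t^q = t`; this is the subfield with `q` elements of `L`
as soon as it has `q` elements. -/
def fixedByPow (L : Type*) [Field L] (q : ℕ) : Set L := {t | t ^ q = t}

/-- The compositum `F · 𝔽_q` inside `L`. -/
noncomputable def compositum (F L : Type*) [Field F] [Field L] [Algebra F L] (q : ℕ) :
    IntermediateField F L :=
  IntermediateField.adjoin F (fixedByPow L q)

/-- The orbit `{σ^k x : k ∈ ℤ}` of `x` under an automorphism `σ` of `L`. -/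
def sigmaOrbit {E L : Type*} [Field E] [Field L] [Algebra E L] (σ : L ≃ₐ[E] L) (x : L) : Set L :=
  {y | ∃ k : ℤ, (σ ^ k) x = y}

/-- The roots in `L` of `f` that are fixed by `σ`. -/
def fixedRoots {F E L : Type*} [Field F] [Field E] [Field L] [Algebra F L] [Algebra E L]
    (σ : L ≃ₐ[E] L) (f : F[X]) : Set L :=
  {x | x ∈ f.rootSet L ∧ σ x = x}

end MCM

/-! Put `b = 1/a`. The proof turns both root sets into geometry of a plane over `𝔽_q`. The
`𝔽_q`-space `planeOf q b` has as its lines exactly the sets `lineOf q b x`, one for each trinomial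
root `x` (`exists_line`, `line_unique`), and `affinePlane q b` is an affine space over it containing
every `1 / (x + y)` for distinct roots `x`, `y`.

If `e` is a root of `C(x) + a`, then `trace n e` lies in `affinePlane q b`, and `point` recovers `e`
from it. On this affine plane `Q(E) = trace n (point q b E) + E` takes only the values 0 and 1
(`trace_point`). The roots of `C(x) + a` correspond to `Q = 0`, while chords have `Q = 1`. In the
direction of a line, `Q` varies by an absolute trace (`trace_point_add`), so on a parallel with
nonzero coordinate exactly half of the points have `Q = 0`. This yields `(q - 1) * (q / 2)` roots,
the degree of `C`, so `C(x) + a` splits in `L` with simple roots.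

An automorphism `σ` fixing `𝔽_q` acts `𝔽_q`-linearly on the plane and preserves the alternating form
`b (v u^q + v^q u)`, hence acts with determinant 1. It is the identity as soon as it fixes all
trinomial roots. With at least three fixed lines it is trivial; with two, no nontrivial power fixes
a nonzero vector; with one, it is unipotent and its fixed points in the affine plane form one
parallel of the fixed line; with none, its powers act freely on the lines, and counting modulo the
order gives a fixed root of `C(x) + a`. -/

namespace MCM

/-! ### Lines, chords, the plane and the quadratic function on it. -/

section Algebra

variable {L : Type*} [Field L] {n q : ℕ} {b : L}

/-- The roots of `x^{q+1} + x + b`. -/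
def trinomialRoots (q : ℕ) (b : L) : Set L := {x | x ^ q * x = x + b}

/-- The `𝔽_q`-line attached to a root `x` of the trinomial. -/
def lineOf (q : ℕ) (b x : L) : Set L := {v | b * v ^ q = x ^ 2 * v}

/-- The elements `1 / (x + y)`, where `y` runs through the roots different from `x`. -/
def chordsAt (q : ℕ) (b x : L) : Set L := {r | b * r ^ q + x ^ 2 * r + x = 0}

/-- The two-dimensional `𝔽_q`-space that is the union of the lines `lineOf q b x`. -/
def planeOf (q : ℕ) (b : L) : Set L := {v | b ^ q * (v ^ q) ^ q + v ^ q + b * v = 0}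

/-- The affine space over `planeOf q b` that contains all chords. -/
def affinePlane (q : ℕ) (b : L) : Set L := {E | b ^ q * (E ^ q) ^ q + E ^ q + b * E = 1}

/-- The polynomial map `∑_{i<n} x^{2^i}`. -/
def trace (n : ℕ) (x : L) : L := ∑ i ∈ Finset.range n, x ^ 2 ^ i

/-- The inverse of `trace n` on the roots of `C(x) + 1/b`. -/
def point (q : ℕ) (b E : L) : L := E ^ 2 + E + b * (E ^ q * E)

/-- The elements of the affine plane that come from roots of `C(x) + 1/b`. -/
def minusPoints (n q : ℕ) (b : L) : Set L :=
  {E | E ∈ affinePlane q b ∧ trace n (point q b E) = E}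

/-- The `𝔽_q`-linear part of `coord`. -/
def coordLin (q : ℕ) (b x v u : L) : L := v * (b * u ^ q + x ^ 2 * u)

/-- The coordinate of `E` transversal to `lineOf q b x`. -/
def coord (q : ℕ) (b x v E : L) : L := v * (b * E ^ q + x ^ 2 * E + x)

theorem coordLin_smul (x v u : L) {t : L} (ht : t ^ q = t) :
    coordLin q b x v (t * u) = t * coordLin q b x v u := by
  simp only [coordLin, mul_pow, ht]; ring

theorem lineOf_smul {x v s : L} (hs : s ^ q = s) (hv : v ∈ lineOf q b x) :
    s * v ∈ lineOf q b x := by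
  simp only [lineOf, Set.mem_ofPred_eq, mul_pow, hs] at *
  grind

variable [CharP L 2]

theorem add_pow_q (hq : q = 2 ^ n) (x y : L) : (x + y) ^ q = x ^ q + y ^ q := by
  subst hq; exact add_pow_char_pow x y 2 n

theorem trace_add (x y : L) : trace n (x + y) = trace n x + trace n y := by
  simp [trace, add_pow_char_pow, Finset.sum_add_distrib]

theorem trace_sq (x : L) : trace n (x ^ 2) = trace n x ^ 2 := by
  simp only [trace, sum_pow_char]
  exact Finset.sum_congr rfl fun i _ => by rw [← pow_mul, ← pow_mul, mul_comm]

theorem trace_sq_add (hq : q = 2 ^ n) (x : L) : trace n x ^ 2 + trace n x = x ^ q + x := by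
  subst hq
  rw [← trace_sq]
  induction n with
  | zero => simp [trace, CharTwo.add_self_eq_zero]
  | succ n ih =>
    simp only [trace, Finset.sum_range_succ] at ih ⊢
    have : (x ^ 2) ^ 2 ^ n = x ^ 2 ^ (n + 1) := by rw [← pow_mul]; ring_nf
    rw [this]
    grind

theorem trace_pow_q (hq : q = 2 ^ n) {t : L} (ht : t ^ q = t) :
    trace n t = 0 ∨ trace n t = 1 := by
  have := trace_sq_add hq t
  have h : trace n t * (trace n t + 1) = 0 := by grind
  rcases mul_eq_zero.1 h with h | h
  · exact Or.inl h
  · right; grind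

theorem root_ne_zero (hb : b ≠ 0) {x : L} (hx : x ∈ trinomialRoots q b) : x ≠ 0 := by
  rintro rfl
  simp only [trinomialRoots, Set.mem_ofPred_eq] at hx
  grind

theorem chord_mem (hq : q = 2 ^ n) {x y : L} (hx : x ∈ trinomialRoots q b)
    (hy : y ∈ trinomialRoots q b) (hxy : x ≠ y) : 1 / (x + y) ∈ chordsAt q b x := by
  have hne : x + y ≠ 0 := by grind
  have h1 : 1 / (x + y) * (x + y) = 1 := by field_simp
  have h2 := congrArg (· ^ q) h1
  simp only [mul_pow, add_pow_q hq, one_pow] at h2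
  simp only [trinomialRoots, chordsAt, Set.mem_ofPred_eq] at *
  generalize 1 / (x + y) = r at *
  grind

theorem root_of_chord (hq : q = 2 ^ n) {x r : L} (hx : x ∈ trinomialRoots q b) (hx0 : x ≠ 0)
    (hr : r ∈ chordsAt q b x) :
    r ≠ 0 ∧ x + 1 / r ∈ trinomialRoots q b ∧ x + 1 / r ≠ x := by
  have hq0 : q ≠ 0 := by subst hq; positivity
  have hr0 : r ≠ 0 := by
    rintro rfl
    simp only [chordsAt, Set.mem_ofPred_eq] at hr
    simp [hq0] at hr
    exact hx0 hr
  have h1 : 1 / r * r = 1 := by field_simp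
  have h2 := congrArg (· ^ q) h1
  simp only [mul_pow, one_pow] at h2
  simp only [trinomialRoots, chordsAt, Set.mem_ofPred_eq] at *
  refine ⟨hr0, ?_, by simpa using hr0⟩
  rw [add_pow_q hq]
  generalize 1 / r = s at *
  grind

theorem chord_add_chord (hq : q = 2 ^ n) {x r s : L} (hr : r ∈ chordsAt q b x)
    (hs : s ∈ chordsAt q b x) : r + s ∈ lineOf q b x := by
  simp only [lineOf, chordsAt, Set.mem_ofPred_eq, add_pow_q hq] at *
  grind

theorem chord_add_line (hq : q = 2 ^ n) {x r v : L} (hr : r ∈ chordsAt q b x)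
    (hv : v ∈ lineOf q b x) : r + v ∈ chordsAt q b x := by
  simp only [lineOf, chordsAt, Set.mem_ofPred_eq, add_pow_q hq] at *
  grind

theorem lineOf_div (hb : b ≠ 0) {x v w : L} (hv : v ∈ lineOf q b x) (hv0 : v ≠ 0)
    (hw : w ∈ lineOf q b x) : (w / v) ^ q = w / v := by
  simp only [lineOf, Set.mem_ofPred_eq] at *
  have h : v ^ q ≠ 0 := pow_ne_zero _ hv0
  rw [div_pow, div_eq_div_iff h hv0]
  apply mul_left_cancel₀ hb
  grind

theorem plane_of_line (hb : b ≠ 0) {x v : L} (hx : x ∈ trinomialRoots q b)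
    (hv : v ∈ lineOf q b x) : v ∈ planeOf q b := by
  have hx0 := root_ne_zero hb hx
  simp only [trinomialRoots, lineOf, planeOf, Set.mem_ofPred_eq] at *
  have h2 := congrArg (· ^ q) hv
  simp only [mul_pow, ← pow_mul, mul_comm 2 q] at h2
  simp only [pow_mul] at h2
  apply mul_left_cancel₀ hb
  apply mul_left_cancel₀ hx0
  apply mul_left_cancel₀ hx0
  generalize x ^ q = X at *
  generalize (v ^ q) ^ q = W at *
  generalize v ^ q = W' at *
  grind

theorem affine_of_chord (hq : q = 2 ^ n) (hb : b ≠ 0) {x r : L} (hx : x ∈ trinomialRoots q b)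
    (hr : r ∈ chordsAt q b x) : r ∈ affinePlane q b := by
  have hx0 := root_ne_zero hb hx
  simp only [trinomialRoots, chordsAt, affinePlane, Set.mem_ofPred_eq] at *
  have hr' : b * r ^ q = x ^ 2 * r + x := by grind
  have h2 := congrArg (· ^ q) hr'
  simp only [mul_pow, add_pow_q hq, ← pow_mul, mul_comm 2 q] at h2
  simp only [pow_mul] at h2
  apply mul_left_cancel₀ hb
  apply mul_left_cancel₀ hx0
  apply mul_left_cancel₀ hx0
  generalize x ^ q = X at *
  generalize (r ^ q) ^ q = W at *
  generalize r ^ q = W' at *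
  grind

theorem plane_add (hq : q = 2 ^ n) {v w : L} (hv : v ∈ planeOf q b) (hw : w ∈ planeOf q b) :
    v + w ∈ planeOf q b := by
  simp only [planeOf, Set.mem_ofPred_eq, add_pow_q hq] at *
  grind

theorem affine_add_plane (hq : q = 2 ^ n) {E v : L} (hE : E ∈ affinePlane q b)
    (hv : v ∈ planeOf q b) : E + v ∈ affinePlane q b := by
  simp only [planeOf, affinePlane, Set.mem_ofPred_eq, add_pow_q hq] at *
  grind

theorem affine_add_affine (hq : q = 2 ^ n) {E E' : L} (hE : E ∈ affinePlane q b)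
    (hE' : E' ∈ affinePlane q b) : E + E' ∈ planeOf q b := by
  simp only [planeOf, affinePlane, Set.mem_ofPred_eq, add_pow_q hq] at *
  grind

/-- For a nonzero `v`, the quotient `z = b v^q / v` satisfies the trinomial equation with `b`
replaced by `b²`; its square root is the required `x`. -/
theorem exists_line (hn : n ≠ 0) (hq : q = 2 ^ n) (hb : b ≠ 0) {v : L} (hv : v ∈ planeOf q b)
    (hv0 : v ≠ 0) : ∃ x ∈ trinomialRoots q b, v ∈ lineOf q b x := by
  obtain ⟨m, rfl⟩ := Nat.exists_eq_succ_of_ne_zero hn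
  set z := b * v ^ q / v with hz
  have hzv : z * v = b * v ^ q := by rw [hz]; field_simp
  have hzv' := congrArg (· ^ q) hzv
  simp only [planeOf, Set.mem_ofPred_eq] at hv
  simp only [mul_pow] at hzv'
  have hvq : v ^ q ≠ 0 := pow_ne_zero _ hv0
  have hz0 : z ≠ 0 := by rw [hz]; positivity
  have hzq : z ^ q * z = z + b ^ 2 := by
    apply mul_left_cancel₀ hv0
    apply mul_left_cancel₀ hvq
    grind
  -- The square root of `z` must be found inside `L`. Since `w = z^(q/2)` satisfies `w² = z^q`, the
  -- equation for `z` becomes `(w + 1)² z = b²`, so `b / (w + 1)` is the root.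
  set w := z ^ 2 ^ m
  have hw : w ^ 2 = z ^ q := by rw [hq, ← pow_mul, pow_succ]
  have hw1 : (w + 1) ^ 2 * z = b ^ 2 := by grind
  have hw2 : w + 1 ≠ 0 := by
    intro h
    rw [h] at hw1
    simp at hw1
    exact hb (pow_eq_zero_iff two_ne_zero |>.1 hw1.symm)
  have hx : (b / (w + 1)) ^ 2 = z := by
    field_simp
    exact hw1.symm
  refine ⟨b / (w + 1), ?_, ?_⟩
  · simp only [trinomialRoots, Set.mem_ofPred_eq]
    generalize b / (w + 1) = x at *
    have h : ((x ^ q) * x + (x + b)) ^ 2 = 0 := by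
      have : (x ^ q) ^ 2 = z ^ q := by rw [← hx, ← pow_mul, ← pow_mul, mul_comm]
      generalize x ^ q = X at *
      generalize z ^ q = Z at *
      grind
    have := pow_eq_zero_iff (two_ne_zero) |>.1 h
    grind
  · simp only [lineOf, Set.mem_ofPred_eq, hx]
    exact hzv.symm

theorem line_unique {x y v : L} (hv0 : v ≠ 0) (hx : v ∈ lineOf q b x) (hy : v ∈ lineOf q b y) :
    x = y := by
  simp only [lineOf, Set.mem_ofPred_eq] at hx hy
  have h : (x + y) ^ 2 = 0 := by
    apply mul_right_cancel₀ hv0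
    grind
  have := pow_eq_zero_iff (two_ne_zero) |>.1 h
  grind

/-- As `x² v = b v^q`, the value is `b (v u^q + v^q u)`: an alternating form in `u` and `v`, with
values in `𝔽_q` by the equation of the plane. -/
theorem coordLin_mem (hq : q = 2 ^ n) (hb : b ≠ 0) {x v u : L} (hx : x ∈ trinomialRoots q b)
    (hv : v ∈ lineOf q b x) (hu : u ∈ planeOf q b) :
    coordLin q b x v u ^ q = coordLin q b x v u := by
  have hx0 := root_ne_zero hb hx
  simp only [trinomialRoots, planeOf, lineOf, coordLin, Set.mem_ofPred_eq] at *
  simp only [mul_pow, add_pow_q hq, ← pow_mul, mul_comm 2 q] at *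
  simp only [pow_mul] at *
  apply mul_left_cancel₀ hb
  apply mul_left_cancel₀ hx0
  apply mul_left_cancel₀ hx0
  generalize x ^ q = X at *
  generalize (u ^ q) ^ q = W at *
  generalize u ^ q = W' at *
  generalize v ^ q = V at *
  grind

theorem coord_eq (x v E r : L) (hq : q = 2 ^ n) (hr : r ∈ chordsAt q b x) :
    coord q b x v E = coordLin q b x v (E + r) := by
  simp only [chordsAt, coord, coordLin, Set.mem_ofPred_eq, add_pow_q hq] at *
  grind

theorem coordLin_add (hq : q = 2 ^ n) (x v u w : L) :
    coordLin q b x v (u + w) = coordLin q b x v u + coordLin q b x v w := by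
  simp only [coordLin, add_pow_q hq]; ring

theorem coordLin_eq_zero {x v u : L} (hv : v ≠ 0) :
    coordLin q b x v u = 0 ↔ u ∈ lineOf q b x := by
  simp only [coordLin, lineOf, Set.mem_ofPred_eq, mul_eq_zero, hv, false_or]
  constructor <;> intro h <;> grind

/-- The increment of `point` is, apart from `s * coord q b x v E`, a sum of two terms `c² + c`,
whose traces collapse to `c^q + c`. -/
theorem trace_point_add (hq : q = 2 ^ n) (hb : b ≠ 0) {x v s E : L} (hx : x ∈ trinomialRoots q b)
    (hv : v ∈ lineOf q b x) (hs : s ^ q = s) :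
    trace n (point q b (E + s * v)) + (E + s * v) =
      trace n (point q b E) + E + trace n (s * coord q b x v E) := by
  have hx0 := root_ne_zero hb hx
  set w := s * v with hw
  have hwl : w ∈ lineOf q b x := lineOf_smul hs hv
  clear_value w
  have e : point q b (E + w) = point q b E + (w ^ 2 + w) + ((x * w) ^ 2 + x * w)
      + s * coord q b x v E := by
    simp only [lineOf, point, coord, Set.mem_ofPred_eq, add_pow_q hq] at *
    grind
  have h3 := trace_sq_add hq w
  have h4 := trace_sq_add hq (x * w)
  rw [← trace_sq, ← trace_add] at h3 h4
  rw [e, trace_add, trace_add, trace_add, h3, h4, mul_pow x w]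
  have : w ^ q + x ^ q * w ^ q + x * w = 0 := by
    apply mul_left_cancel₀ hb
    apply mul_left_cancel₀ hx0
    simp only [trinomialRoots, lineOf, Set.mem_ofPred_eq] at *
    grind
  grind

/-- With `y = point q b E`, the affine equation gives `y^q + y = E² + E`, so `trace n y` and `E`
have the same image under `c ↦ c² + c`. -/
theorem trace_point (hq : q = 2 ^ n) {E : L} (hE : E ∈ affinePlane q b) :
    trace n (point q b E) = E ∨ trace n (point q b E) = E + 1 := by
  have h := trace_sq_add hq (point q b E)
  have h1 : point q b E ^ q = b * (E ^ q * E) := by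
    simp only [affinePlane, point, Set.mem_ofPred_eq, add_pow_q hq, mul_pow] at *
    simp only [← pow_mul, mul_comm 2 q] at *
    simp only [pow_mul] at *
    grind
  rw [h1] at h
  have : (trace n (point q b E) + E) * (trace n (point q b E) + E + 1) = 0 := by
    generalize trace n (point q b E) = t at *
    simp only [point] at *
    grind
  rcases mul_eq_zero.1 this with h | h
  · left; grind
  · right; grind

theorem trace_point_chord (hq : q = 2 ^ n) (hb : b ≠ 0) {x r : L} (hx : x ∈ trinomialRoots q b)
    (hr : r ∈ chordsAt q b x) : trace n (point q b r) = r + 1 := by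
  have hx0 := root_ne_zero hb hx
  have e : point q b r = (r * (1 + x)) ^ 2 + r * (1 + x) := by
    simp only [chordsAt, point, Set.mem_ofPred_eq] at *
    grind
  have h := trace_sq_add hq (r * (1 + x))
  rw [← trace_sq, ← trace_add] at h
  rw [e, h, mul_pow, add_pow_q hq, one_pow]
  apply mul_left_cancel₀ hb
  apply mul_left_cancel₀ hx0
  simp only [trinomialRoots, chordsAt, Set.mem_ofPred_eq] at *
  grind

end Algebra

end MCM

namespace MCM

/-! ### Cardinalities of `𝔽_q`, of trace fibres and of `minusPoints`. -/

section Counting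

variable {L : Type*} [Field L]

theorem finite_and_ncard_le_natDegree {p : L[X]} (hp : p ≠ 0) {A : Set L}
    (h : ∀ x ∈ A, p.eval x = 0) : A.Finite ∧ A.ncard ≤ p.natDegree := by
  classical
  have hsub : A ⊆ (p.roots.toFinset : Set L) := fun x hx => by
    simpa [hp] using h x hx
  refine ⟨(Finset.finite_toSet _).subset hsub, ?_⟩
  calc A.ncard ≤ (p.roots.toFinset : Set L).ncard :=
        Set.ncard_le_ncard hsub (Finset.finite_toSet _)
    _ = p.roots.toFinset.card := Set.ncard_coe_finset _
    _ ≤ p.roots.card := Multiset.toFinset_card_le _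
    _ ≤ p.natDegree := Polynomial.card_roots' p

variable {n q : ℕ} {b : L}

theorem injOn_point : Set.InjOn (point q b) (minusPoints n q b) := fun E hE E' hE' h => by
  rw [← hE.2, ← hE'.2, h]

theorem fixedByPow_finite_and_le (hn : n ≠ 0) (hq : q = 2 ^ n) :
    (fixedByPow L q).Finite ∧ (fixedByPow L q).ncard ≤ q := by
  have h := finite_and_ncard_le_natDegree
    (FiniteField.X_pow_card_pow_sub_X_ne_zero L hn one_lt_two) (A := fixedByPow L q)
    (fun x hx => by
      simp only [fixedByPow, Set.mem_ofPred_eq] at hx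
      simp [← hq, hx])
  rwa [FiniteField.X_pow_card_pow_sub_X_natDegree_eq L hn one_lt_two, ← hq] at h

theorem affinePlane_finite (hq : q = 2 ^ n) : (affinePlane q b).Finite := by
  have hq0 : q ≠ 0 := by subst hq; positivity
  refine (finite_and_ncard_le_natDegree
    (p := C (b ^ q) * (X ^ q) ^ q + X ^ q + C b * X - 1) ?_ ?_).1
  · intro h
    have := congrArg (eval 0) h
    simp [hq0] at this
  · intro x hx
    simp only [affinePlane, Set.mem_ofPred_eq] at hx
    simp only [eval_add, eval_sub, eval_mul, eval_C, eval_pow, eval_X, eval_one, hx, sub_self]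

theorem exists_ne_root (hn : n ≠ 0) (hq : q = 2 ^ n) (hR : (trinomialRoots q b).ncard = q + 1)
    (x : L) : ∃ y ∈ trinomialRoots q b, y ≠ x :=
  Set.exists_ne_of_one_lt_ncard (by rw [hR]; subst hq; have := Nat.one_lt_two_pow hn; omega) x

theorem exists_ne_ne_root (hn : n ≠ 0) (hq : q = 2 ^ n)
    (hR : (trinomialRoots q b).ncard = q + 1) (x y : L) :
    ∃ z ∈ trinomialRoots q b, z ≠ x ∧ z ≠ y := by
  by_contra! h
  have hsub : trinomialRoots q b ⊆ {x, y} := fun z hz => by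
    by_cases hzx : z = x
    · simp [hzx]
    · simp [h z hz hzx]
  have := Set.ncard_le_ncard hsub
  have h2 : ({x, y} : Set L).ncard ≤ 2 := by simpa using Set.ncard_insert_le x {y}
  have := Nat.one_lt_two_pow hn
  omega

theorem ncard_trace_le (hn : n ≠ 0) (hq : q = 2 ^ n) (c : L) :
    {s : L | s ^ q = s ∧ trace n s = c}.ncard ≤ q / 2 := by
  obtain ⟨m, rfl⟩ := Nat.exists_eq_succ_of_ne_zero hn
  have hdeg : (∑ i ∈ Finset.range m, (X : L[X]) ^ 2 ^ i - C c).degree < (2 ^ m : ℕ) := by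
    rw [← mem_degreeLT]
    refine sub_mem (sum_mem fun i hi => ?_) ?_
    · rw [mem_degreeLT, degree_X_pow]
      exact_mod_cast Nat.pow_lt_pow_right one_lt_two (Finset.mem_range.1 hi)
    · rw [mem_degreeLT]
      exact lt_of_le_of_lt degree_C_le (by exact_mod_cast Nat.two_pow_pos m)
  have hm := monic_X_pow_add hdeg
  have h := (finite_and_ncard_le_natDegree hm.ne_zero
    (A := {s : L | s ^ q = s ∧ trace (m + 1) s = c}) ?_).2
  · rw [natDegree_add_eq_left_of_degree_lt (by rwa [degree_X_pow]), natDegree_X_pow] at h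
    refine h.trans (le_of_eq ?_)
    rw [hq, pow_succ]; simp
  · rintro s ⟨-, hs⟩
    simp only [trace, Finset.sum_range_succ] at hs
    simp only [eval_add, eval_sub, eval_finsetSum, eval_pow, eval_X, eval_C]
    rw [← hs]; ring

variable [CharP L 2]

theorem exists_mem_lineOf (hn : n ≠ 0) (hq : q = 2 ^ n)
    (hR : (trinomialRoots q b).ncard = q + 1) {x : L} (hx : x ∈ trinomialRoots q b) :
    ∃ v ∈ lineOf q b x, v ≠ 0 := by
  obtain ⟨y, hy, hyx⟩ := exists_ne_root hn hq hR x
  obtain ⟨z, hz, hzx, hzy⟩ := exists_ne_ne_root hn hq hR x y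
  refine ⟨_, chord_add_chord hq (chord_mem hq hx hy hyx.symm) (chord_mem hq hx hz hzx.symm), ?_⟩
  have h1 : x + y ≠ 0 := by grind
  have h2 : x + z ≠ 0 := by grind
  intro h
  field_simp at h
  grind

/-- The `q` chords at one root `x` differ by vectors of a single line, and dividing by a nonzero
vector of that line injects them into `𝔽_q`. -/
theorem ncard_fixedByPow (hn : n ≠ 0) (hq : q = 2 ^ n) (hb : b ≠ 0)
    (hR : (trinomialRoots q b).ncard = q + 1) : (fixedByPow L q).ncard = q := by
  obtain ⟨hfin, hle⟩ := fixedByPow_finite_and_le (L := L) hn hq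
  refine le_antisymm hle ?_
  obtain ⟨x, hx, -⟩ := exists_ne_root hn hq hR 0
  obtain ⟨y, hy, hyx⟩ := exists_ne_root hn hq hR x
  obtain ⟨v, hv, hv0⟩ := exists_mem_lineOf hn hq hR hx
  have hr := chord_mem hq hx hy hyx.symm
  have hcard : (trinomialRoots q b \ {x}).ncard = q := by
    rw [Set.ncard_sdiff_singleton_of_mem hx, hR]; rfl
  calc q = (trinomialRoots q b \ {x}).ncard := hcard.symm
    _ ≤ (fixedByPow L q).ncard := by
      refine Set.ncard_le_ncard_of_injOn (fun z => (1 / (x + z) + 1 / (x + y)) / v) ?_ ?_ hfin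
      · intro z hz
        exact lineOf_div hb hv hv0
          (chord_add_chord hq (chord_mem hq hx hz.1 (Ne.symm hz.2)) hr)
      · intro z hz w hw h
        have hz2 : z ≠ x := hz.2
        have hw2 : w ≠ x := hw.2
        have h1 : x + z ≠ 0 := by grind
        have h2 : x + w ≠ 0 := by grind
        simp only [div_left_inj' hv0, add_left_inj, one_div, inv_inj, add_right_inj] at h
        exact h

/-- Each of the two fibres has at most `q / 2` elements by degree, and together they cover all `q`.
-/
theorem ncard_trace_eq (hn : n ≠ 0) (hq : q = 2 ^ n) (hF : (fixedByPow L q).ncard = q) {c : L}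
    (hc : c = 0 ∨ c = 1) : {s : L | s ^ q = s ∧ trace n s = c}.ncard = q / 2 := by
  obtain ⟨hfin, -⟩ := fixedByPow_finite_and_le (L := L) hn hq
  have h0 := ncard_trace_le (L := L) hn hq 0
  have h1 := ncard_trace_le (L := L) hn hq 1
  have hsub : ∀ c : L, {s : L | s ^ q = s ∧ trace n s = c} ⊆ fixedByPow L q :=
    fun c s hs => hs.1
  have hunion : fixedByPow L q = {s : L | s ^ q = s ∧ trace n s = 0} ∪
      {s : L | s ^ q = s ∧ trace n s = 1} := by
    ext s
    constructor
    · intro hs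
      rcases trace_pow_q hq hs with h | h
      · exact Or.inl ⟨hs, h⟩
      · exact Or.inr ⟨hs, h⟩
    · rintro (h | h) <;> exact h.1
  have hle := Set.ncard_union_le {s : L | s ^ q = s ∧ trace n s = 0}
    {s : L | s ^ q = s ∧ trace n s = 1}
  rw [← hunion, hF] at hle
  have hev : q = 2 * (q / 2) := by
    obtain ⟨m, rfl⟩ := Nat.exists_eq_succ_of_ne_zero hn
    rw [hq, pow_succ]; omega
  rcases hc with rfl | rfl <;> omega

/-- Multiplication by the nonzero coordinate of `E` carries the set onto a trace fibre, over 0 or 1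
according to the value of `Q` at `E`. -/
theorem ncard_minus_coset (hn : n ≠ 0) (hq : q = 2 ^ n) (hb : b ≠ 0)
    (hF : (fixedByPow L q).ncard = q) {x v E : L} (hx : x ∈ trinomialRoots q b)
    (hv : v ∈ lineOf q b x) (hE : E ∈ affinePlane q b) (hE0 : coord q b x v E ≠ 0)
    (hEq : coord q b x v E ^ q = coord q b x v E) :
    {s : L | s ^ q = s ∧ E + s * v ∈ minusPoints n q b}.ncard = q / 2 := by
  obtain ⟨c, hc, hcE⟩ : ∃ c : L, (c = 0 ∨ c = 1) ∧ trace n (point q b E) = E + c := by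
    rcases trace_point hq hE with h | h
    · exact ⟨0, Or.inl rfl, by simpa using h⟩
    · exact ⟨1, Or.inr rfl, h⟩
  rw [← ncard_trace_eq hn hq hF hc, ← Set.ncard_image_of_injective _ (mul_left_injective₀ hE0)]
  congr 1
  have key : ∀ s : L, s ^ q = s → (E + s * v ∈ minusPoints n q b ↔
      trace n (s * coord q b x v E) = c) := fun s hs => by
    have h := trace_point_add (E := E) hq hb hx hv hs
    have hmem := affine_add_plane hq hE (plane_of_line hb hx (lineOf_smul hs hv))
    simp only [minusPoints, Set.mem_ofPred_eq, hmem, true_and]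
    generalize trace n (s * coord q b x v E) = T at *
    constructor <;> intro h' <;> grind
  ext t
  constructor
  · rintro ⟨s, ⟨hs, hs'⟩, rfl⟩
    exact ⟨by simp only [mul_pow, hs, hEq], (key s hs).1 hs'⟩
  · rintro ⟨ht, ht'⟩
    have hs : (t / coord q b x v E) ^ q = t / coord q b x v E := by rw [div_pow, ht, hEq]
    refine ⟨t / coord q b x v E, ⟨hs, (key _ hs).2 ?_⟩, ?_⟩
    · rwa [div_mul_cancel₀ _ hE0]
    · exact div_mul_cancel₀ _ hE0

theorem coordLin_ne_zero {x y v w : L} (hxy : x ≠ y) (hv0 : v ≠ 0) (hw : w ∈ lineOf q b y)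
    (hw0 : w ≠ 0) : coordLin q b x v w ≠ 0 := fun h =>
  hxy (line_unique hw0 ((coordLin_eq_zero hv0).1 h) hw)

theorem exists_chord (hn : n ≠ 0) (hq : q = 2 ^ n) (hR : (trinomialRoots q b).ncard = q + 1)
    {x : L} (hx : x ∈ trinomialRoots q b) : ∃ r, r ∈ chordsAt q b x := by
  obtain ⟨y, hy, hyx⟩ := exists_ne_root hn hq hR x
  exact ⟨_, chord_mem hq hx hy hyx.symm⟩

theorem coord_add_smul (hq : q = 2 ^ n) {x v r w t : L} (hr : r ∈ chordsAt q b x)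
    (ht : t ^ q = t) : coord q b x v (r + t * w) = t * coordLin q b x v w := by
  rw [coord_eq x v _ r hq hr, ← coordLin_smul x v w ht]
  congr 1
  grind

theorem coord_line (hq : q = 2 ^ n) {x v E w : L} (hw : w ∈ lineOf q b x) :
    coord q b x v (E + w) = coord q b x v E := by
  simp only [lineOf, coord, Set.mem_ofPred_eq, add_pow_q hq] at *
  grind

/-- In the coordinates `r + t w + s v`, each of the `q - 1` parallels with `t ≠ 0` contributes `q /
2` points. Equality comes later, from the degree of `C`. -/
theorem le_ncard_minusPoints (hn : n ≠ 0) (hq : q = 2 ^ n) (hb : b ≠ 0)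
    (hR : (trinomialRoots q b).ncard = q + 1) :
    (q - 1) * (q / 2) ≤ (minusPoints n q b).ncard := by
  classical
  have hF := ncard_fixedByPow hn hq hb hR
  obtain ⟨hfin, -⟩ := fixedByPow_finite_and_le (L := L) hn hq
  obtain ⟨x, hx, -⟩ := exists_ne_root hn hq hR 0
  obtain ⟨y, hy, hyx⟩ := exists_ne_root hn hq hR x
  obtain ⟨v, hv, hv0⟩ := exists_mem_lineOf hn hq hR hx
  obtain ⟨w, hw, hw0⟩ := exists_mem_lineOf hn hq hR hy
  obtain ⟨r, hr⟩ := exists_chord hn hq hR hx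
  have hk : coordLin q b x v w ≠ 0 := coordLin_ne_zero hyx.symm hv0 hw hw0
  have hkq := coordLin_mem hq hb hx hv (plane_of_line hb hy hw)
  have hmem : ∀ t : L, t ^ q = t → r + t * w ∈ affinePlane q b := fun t ht =>
    affine_add_plane hq (affine_of_chord hq hb hx hr) (plane_of_line hb hy (lineOf_smul ht hw))
  set A := hfin.toFinset with hA
  have hAc : A.card = q := by rw [← hF, Set.ncard_eq_toFinset_card _ hfin]
  have hAm : ∀ t, t ∈ A ↔ t ^ q = t := fun t => by simp [hA, fixedByPow]
  set P := (A.erase 0).sigma fun t => A.filter fun s => r + t * w + s * v ∈ minusPoints n q b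
    with hP
  have hPc : P.card = (q - 1) * (q / 2) := by
    rw [hP, Finset.card_sigma, Finset.sum_const_nat (m := q / 2), Finset.card_erase_of_mem, hAc]
    · rw [hAm]
      apply zero_pow
      subst hq
      positivity
    · intro t ht
      rw [Finset.mem_erase, hAm] at ht
      have hc := coord_add_smul (v := v) (w := w) hq hr ht.2
      rw [← ncard_minus_coset hn hq hb hF hx hv (hmem t ht.2)
        (by rw [hc]; exact mul_ne_zero ht.1 hk) (by rw [hc, mul_pow, hkq, ht.2]),
        ← Set.ncard_coe_finset]
      congr 1
      ext s
      simp [hAm]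
  rw [← hPc, ← Set.ncard_coe_finset]
  refine Set.ncard_le_ncard_of_injOn (fun z => r + z.1 * w + z.2 * v) ?_ ?_
    ((affinePlane_finite hq).subset fun E hE => hE.1)
  · rintro ⟨t, s⟩ h
    simp only [hP, Finset.coe_sigma, Set.mem_sigma_iff, Finset.mem_coe, Finset.mem_filter] at h
    exact h.2.2
  · rintro ⟨t, s⟩ h ⟨t', s'⟩ h' heq
    simp only [hP, Finset.coe_sigma, Set.mem_sigma_iff, Finset.mem_coe, Finset.mem_filter,
      Finset.mem_erase, hAm] at h h' heq
    have e := congrArg (coord q b x v) heq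
    rw [coord_line hq (lineOf_smul h.2.1 hv), coord_line hq (lineOf_smul h'.2.1 hv),
      coord_add_smul hq hr h.1.2, coord_add_smul hq hr h'.1.2] at e
    obtain rfl := mul_right_cancel₀ hk e
    obtain rfl := mul_right_cancel₀ hv0 (add_left_cancel heq)
    rfl

/-- The nonzero solutions of `b * Tr(e)^{q+1} = e^q`, which are the roots of `C(x) + 1/b`. -/
def mcmRoots (n q : ℕ) (b : L) : Set L := {e | e ≠ 0 ∧ b * (trace n e ^ q * trace n e) = e ^ q}

theorem point_trace (hq : q = 2 ^ n) {e : L} (he : e ∈ mcmRoots n q b) :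
    point q b (trace n e) = e := by
  have h := trace_sq_add hq e
  have h2 := he.2
  simp only [point]
  grind

theorem trace_mem_minusPoints (hq : q = 2 ^ n) {e : L} (he : e ∈ mcmRoots n q b) :
    trace n e ∈ minusPoints n q b := by
  refine ⟨?_, by rw [point_trace hq he]⟩
  have hq0 : q ≠ 0 := by subst hq; positivity
  have h := trace_sq_add hq e
  obtain ⟨he0, h2⟩ := he
  have hE : trace n e ≠ 0 := by
    intro h0
    rw [h0] at h2
    simp [hq0] at h2
    exact he0 ((pow_eq_zero_iff hq0).1 h2.symm)
  have hEq := pow_ne_zero q hE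
  have h3 := congrArg (· ^ q) h
  have h4 := congrArg (· ^ q) h2
  simp only [mul_pow, add_pow_q hq, ← pow_mul, mul_comm 2 q] at h3 h4
  simp only [pow_mul] at h3 h4
  simp only [affinePlane, Set.mem_ofPred_eq]
  generalize trace n e = E at *
  apply mul_left_cancel₀ hEq
  grind

theorem point_mem_mcmRoots (hq : q = 2 ^ n) (hb : b ≠ 0) {E : L}
    (hE : E ∈ minusPoints n q b) : point q b E ∈ mcmRoots n q b := by
  have hq0 : q ≠ 0 := by subst hq; positivity
  have hE0 : E ≠ 0 := by
    rintro rfl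
    have := hE.1
    simp [affinePlane, hq0] at this
  obtain ⟨h1, h2⟩ := hE
  have h3 : point q b E ^ q = b * (E ^ q * E) := by
    simp only [affinePlane, point, Set.mem_ofPred_eq, add_pow_q hq, mul_pow] at *
    simp only [← pow_mul, mul_comm 2 q] at *
    simp only [pow_mul] at *
    grind
  refine ⟨?_, by rw [h2, h3]⟩
  intro h0
  rw [h0, zero_pow hq0] at h3
  have : b * (E ^ q * E) ≠ 0 := mul_ne_zero hb (mul_ne_zero (pow_ne_zero _ hE0) hE0)
  exact this h3.symm

theorem image_point_minusPoints (hq : q = 2 ^ n) (hb : b ≠ 0) :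
    point q b '' minusPoints n q b = mcmRoots n q b := by
  ext e
  constructor
  · rintro ⟨E, hE, rfl⟩
    exact point_mem_mcmRoots hq hb hE
  · intro he
    exact ⟨_, trace_mem_minusPoints hq he, point_trace hq he⟩

theorem ncard_mcmRoots (hq : q = 2 ^ n) (hb : b ≠ 0) :
    (mcmRoots n q b).ncard = (minusPoints n q b).ncard := by
  rw [← image_point_minusPoints hq hb, injOn_point.ncard_image]

end Counting

end MCM

namespace MCM

/-! ### Orbits of a cyclic group of automorphisms. -/

section Orbits

variable {E L : Type*} [Field E] [Field L] [Algebra E L] {σ : L ≃ₐ[E] L}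

theorem mem_sigmaOrbit_self (x : L) : x ∈ sigmaOrbit σ x := ⟨0, by simp⟩

theorem sigmaOrbit_eq_of_mem {x y : L} (h : y ∈ sigmaOrbit σ x) :
    sigmaOrbit σ y = sigmaOrbit σ x := by
  obtain ⟨k, rfl⟩ := h
  ext z
  constructor
  · rintro ⟨l, rfl⟩
    exact ⟨l + k, by rw [zpow_add]; rfl⟩
  · rintro ⟨l, rfl⟩
    refine ⟨l - k, ?_⟩
    rw [← AlgEquiv.mul_apply, ← zpow_add, sub_add_cancel]

theorem ncard_sigmaOrbit {x : L} (h : ∀ k : ℤ, (σ ^ k) x = x → σ ^ k = 1) :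
    (sigmaOrbit σ x).ncard = orderOf σ := by
  have e : sigmaOrbit σ x = Set.range fun g : Subgroup.zpowers σ => (g : L ≃ₐ[E] L) x := by
    ext y
    constructor
    · rintro ⟨k, rfl⟩
      exact ⟨⟨σ ^ k, k, rfl⟩, rfl⟩
    · rintro ⟨⟨_, k, rfl⟩, rfl⟩
      exact ⟨k, rfl⟩
  rw [e, Set.ncard_range_of_injective, Nat.card_zpowers]
  rintro ⟨_, k, rfl⟩ ⟨_, l, rfl⟩ hkl
  simp only at hkl
  have : (σ ^ (l - k)) x = x := by
    rw [sub_eq_neg_add, zpow_add, AlgEquiv.mul_apply, ← hkl, ← AlgEquiv.mul_apply, ← zpow_add,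
      neg_add_cancel, zpow_zero, AlgEquiv.one_apply]
  have := h _ this
  rw [zpow_sub, mul_inv_eq_one] at this
  exact Subtype.ext this.symm

theorem ncard_eq_mul_ncard_orbits {X : Set L} (hfin : X.Finite)
    (hX : ∀ k : ℤ, ∀ x ∈ X, (σ ^ k) x ∈ X) {d : ℕ} (hd : ∀ x ∈ X, (sigmaOrbit σ x).ncard = d) :
    X.ncard = d * {O : Set L | ∃ x ∈ X, O = sigmaOrbit σ x}.ncard := by
  classical
  have e : {O : Set L | ∃ x ∈ X, O = sigmaOrbit σ x} =
      (hfin.toFinset.image (sigmaOrbit σ) : Set (Set L)) := by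
    ext O
    simp [eq_comm]
  rw [e, Set.ncard_coe_finset, Set.ncard_eq_toFinset_card _ hfin,
    Finset.card_eq_sum_card_image (sigmaOrbit σ), Finset.sum_const_nat (m := d), mul_comm]
  intro O hO
  obtain ⟨x, hx, rfl⟩ := Finset.mem_image.1 hO
  rw [Set.Finite.mem_toFinset] at hx
  rw [← hd x hx, ← Set.ncard_coe_finset]
  congr 1
  ext y
  simp only [Finset.coe_filter, Set.Finite.mem_toFinset, Set.mem_ofPred_eq]
  constructor
  · rintro ⟨-, h⟩
    rw [← h]
    exact mem_sigmaOrbit_self y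
  · intro h
    refine ⟨?_, sigmaOrbit_eq_of_mem h⟩
    obtain ⟨k, rfl⟩ := h
    exact hX k x hx

theorem zpow_apply_comm (k : ℤ) (x : L) : (σ ^ k) (σ x) = σ ((σ ^ k) x) := by
  rw [← AlgEquiv.mul_apply, ← AlgEquiv.mul_apply, ((Commute.refl σ).zpow_left k).eq]

theorem map_trace (n : ℕ) (σ : L ≃ₐ[E] L) (e : L) : σ (trace n e) = trace n (σ e) := by
  simp [trace]

theorem ncard_sigmaOrbit_eq_two (h2 : σ ^ 2 = 1) {z : L} (hz : σ z ≠ z) :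
    (sigmaOrbit σ z).ncard = 2 := by
  have h1 : σ ≠ 1 := by rintro rfl; exact hz rfl
  rw [ncard_sigmaOrbit, orderOf_eq_prime h2 h1]
  intro k hk
  obtain ⟨m, rfl | rfl⟩ := Int.even_or_odd' k
  · rw [zpow_mul, zpow_ofNat, h2, one_zpow]
  · rw [zpow_add, zpow_mul, zpow_ofNat, h2, one_zpow, one_mul, zpow_one] at hk
    exact absurd hk hz

end Orbits

/-- An extension `L / E` generated by the roots of `x^{q+1} + x + b`, with `b` and the field
with `q` elements fixed by all automorphisms. -/
structure RootExtension (E : Type*) {L : Type*} [Field E] [Field L] [Algebra E L]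
    (n q : ℕ) (b : L) : Prop where
  n_ne : n ≠ 0
  q_eq : q = 2 ^ n
  b_ne : b ≠ 0
  ncard_roots : (trinomialRoots q b).ncard = q + 1
  map_b : ∀ σ : L ≃ₐ[E] L, σ b = b
  map_fixedByPow : ∀ σ : L ≃ₐ[E] L, ∀ t : L, t ^ q = t → σ t = t
  eq_one : ∀ σ : L ≃ₐ[E] L, (∀ x ∈ trinomialRoots q b, σ x = x) → σ = 1

/-! ### The action of `σ` on the plane, according to its fixed lines. -/

namespace RootExtension

variable {E L : Type*} [Field E] [Field L] [Algebra E L] {n q : ℕ} {b : L}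

section Maps

variable (D : RootExtension E n q b) (σ : L ≃ₐ[E] L)

include D

theorem map_root {x : L} (hx : x ∈ trinomialRoots q b) : σ x ∈ trinomialRoots q b := by
  have := congrArg σ hx
  simpa [trinomialRoots, D.map_b] using this

theorem map_line {x v : L} (hv : v ∈ lineOf q b x) : σ v ∈ lineOf q b (σ x) := by
  have := congrArg σ hv
  simpa [lineOf, D.map_b] using this

theorem map_chord {x r : L} (hr : r ∈ chordsAt q b x) : σ r ∈ chordsAt q b (σ x) := by
  have := congrArg σ hr
  simpa [chordsAt, D.map_b] using this

theorem map_plane {v : L} (hv : v ∈ planeOf q b) : σ v ∈ planeOf q b := by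
  have := congrArg σ hv
  simpa [planeOf, D.map_b] using this

theorem map_mcmRoot {e : L} (he : e ∈ mcmRoots n q b) : σ e ∈ mcmRoots n q b := by
  refine ⟨by simpa using he.1, ?_⟩
  have := congrArg σ he.2
  simpa [trace, D.map_b] using this

theorem map_point (e : L) : σ (point q b e) = point q b (σ e) := by
  simp [point, D.map_b]

theorem map_coordLin (x v u : L) :
    σ (coordLin q b x v u) = coordLin q b (σ x) (σ v) (σ u) := by
  simp [coordLin, D.map_b]

theorem finite_roots : (trinomialRoots q b).Finite :=
  -- An infinite set has `ncard` 0, so a positive count proves finiteness.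
  Set.finite_of_ncard_ne_zero (by rw [D.ncard_roots]; omega)

end Maps

variable [CharP L 2] (D : RootExtension E n q b)

include D

theorem finite_mcmRoots : (mcmRoots n q b).Finite := by
  rw [← image_point_minusPoints D.q_eq D.b_ne]
  exact ((affinePlane_finite D.q_eq).subset fun _ h => h.1).image _

theorem ncard_fixed_mcmRoots (σ : L ≃ₐ[E] L) :
    {e | e ∈ mcmRoots n q b ∧ σ e = e}.ncard = {A | A ∈ minusPoints n q b ∧ σ A = A}.ncard := by
  have h : Set.InjOn (point q b) {A | A ∈ minusPoints n q b ∧ σ A = A} :=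
    injOn_point.mono fun _ h => h.1
  rw [← h.ncard_image]
  congr 1
  ext e
  constructor
  · rintro ⟨he, hσ⟩
    refine ⟨trace n e, ⟨trace_mem_minusPoints D.q_eq he, ?_⟩, point_trace D.q_eq he⟩
    rw [map_trace, hσ]
  · rintro ⟨A, ⟨hA, hσ⟩, rfl⟩
    exact ⟨point_mem_mcmRoots D.q_eq D.b_ne hA, by rw [D.map_point, hσ]⟩

/-- Every chord at `x` is `r + t v` with `t ∈ 𝔽_q`, hence is fixed, and a chord at `x` determines
its other root. -/
theorem eq_one_of_chord {σ : L ≃ₐ[E] L} {x v r : L} (hx : x ∈ trinomialRoots q b) (hσx : σ x = x)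
    (hv : v ∈ lineOf q b x) (hv0 : v ≠ 0) (hσv : σ v = v) (hr : r ∈ chordsAt q b x)
    (hσr : σ r = r) : σ = 1 := by
  refine D.eq_one σ fun y hy => ?_
  by_cases hxy : y = x
  · rw [hxy, hσx]
  have hne : x + y ≠ 0 := by grind
  have h := lineOf_div D.b_ne hv hv0
    (chord_add_chord D.q_eq (chord_mem D.q_eq hx hy (Ne.symm hxy)) hr)
  have h2 := D.map_fixedByPow σ _ h
  rw [map_div₀, hσv, div_left_inj' hv0, map_add, hσr, add_left_inj, map_div₀, map_one, map_add,
    hσx, one_div, one_div, inv_inj, add_right_inj] at h2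
  exact h2

/-- The line of `v` belongs to a fixed root `z`; one of `x`, `y` differs from `z` and gives a fixed
chord at `z`. -/
theorem eq_one_of_vec {σ : L ≃ₐ[E] L} {x y v : L} (hx : x ∈ trinomialRoots q b)
    (hy : y ∈ trinomialRoots q b) (hxy : x ≠ y) (hσx : σ x = x) (hσy : σ y = y)
    (hv : v ∈ planeOf q b) (hv0 : v ≠ 0) (hσv : σ v = v) : σ = 1 := by
  obtain ⟨z, hz, hvz⟩ := exists_line D.n_ne D.q_eq D.b_ne hv hv0
  have hσz : σ z = z := line_unique hv0 (hσv ▸ D.map_line σ hvz) hvz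
  obtain ⟨w, hw, hσw, hwz⟩ : ∃ w ∈ trinomialRoots q b, σ w = w ∧ w ≠ z := by
    by_cases h : x = z
    · exact ⟨y, hy, hσy, fun h' => hxy (h.trans h'.symm)⟩
    · exact ⟨x, hx, hσx, h⟩
  exact D.eq_one_of_chord hz hσz hvz hv0 hσv (chord_mem D.q_eq hz hw hwz.symm)
    (by rw [map_div₀, map_one, map_add, hσz, hσw])

theorem exists_fixed_root_of_vec {σ : L ≃ₐ[E] L} {v : L} (hv : v ∈ planeOf q b) (hv0 : v ≠ 0)
    (hσv : σ v = v) : ∃ x ∈ trinomialRoots q b, σ x = x := by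
  obtain ⟨z, hz, hvz⟩ := exists_line D.n_ne D.q_eq D.b_ne hv hv0
  exact ⟨z, hz, line_unique hv0 (hσv ▸ D.map_line σ hvz) hvz⟩

theorem eq_one_of_three {σ : L ≃ₐ[E] L} {x y z : L} (hx : x ∈ trinomialRoots q b)
    (hy : y ∈ trinomialRoots q b) (hz : z ∈ trinomialRoots q b) (hxy : x ≠ y) (hxz : x ≠ z)
    (hyz : y ≠ z) (hσx : σ x = x) (hσy : σ y = y) (hσz : σ z = z) : σ = 1 := by
  refine D.eq_one_of_vec (v := 1 / (x + y) + 1 / (x + z)) hx hy hxy hσx hσy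
    (plane_of_line D.b_ne hx
      (chord_add_chord D.q_eq (chord_mem D.q_eq hx hy hxy) (chord_mem D.q_eq hx hz hxz))) ?_
    (by simp [hσx, hσy, hσz])
  have h1 : x + y ≠ 0 := by grind
  have h2 : x + z ≠ 0 := by grind
  intro h
  field_simp at h
  grind

theorem minus_add_chord_ne_zero {A x r : L} (hA : A ∈ minusPoints n q b)
    (hx : x ∈ trinomialRoots q b) (hr : r ∈ chordsAt q b x) : A + r ≠ 0 := by
  intro h
  have h1 := trace_point_chord D.q_eq D.b_ne hx hr
  have h2 := hA.2
  have : A = r := by grind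
  rw [this] at h2
  grind

theorem orbits_of_two_fixed {σ : L ≃ₐ[E] L} {x y : L} (hx : x ∈ trinomialRoots q b)
    (hy : y ∈ trinomialRoots q b) (hxy : x ≠ y) (hσx : σ x = x) (hσy : σ y = y) :
    orderOf σ ∣ q - 1 ∧
    (∀ z ∈ trinomialRoots q b, σ z ≠ z → (sigmaOrbit σ z).ncard = orderOf σ) ∧
    (∀ e ∈ mcmRoots n q b, (sigmaOrbit σ e).ncard = orderOf σ) := by
  have hfix : ∀ {w : L}, σ w = w → ∀ k : ℤ, (σ ^ k) w = w := fun {w} hw k =>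
    (MulAction.mem_stabilizer_iff (G := L ≃ₐ[E] L) (a := w)).1
      (Subgroup.zpow_mem _ (MulAction.mem_stabilizer_iff.2 hw) k)
  refine ⟨?_, ?_, ?_⟩
  · obtain ⟨v, hv, hv0⟩ := exists_mem_lineOf D.n_ne D.q_eq D.ncard_roots hx
    have hc := lineOf_div D.b_ne hv hv0 (hσx ▸ D.map_line σ hv)
    have hσv : σ v = (σ v / v) * v := by field_simp
    set c := σ v / v
    have hc0 : c ≠ 0 := by
      intro h
      rw [h, zero_mul] at hσv
      exact hv0 (by simpa using hσv)
    have hpow : ∀ k : ℕ, (σ ^ k) v = c ^ k * v := by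
      intro k
      induction k with
      | zero => simp
      | succ k ih =>
        rw [pow_succ', AlgEquiv.mul_apply, ih, map_mul, map_pow, D.map_fixedByPow σ c hc, hσv]
        ring
    have hq0 : q ≠ 0 := by have := D.q_eq; subst this; positivity
    have hc1 : c ^ (q - 1) = 1 := by
      apply mul_right_cancel₀ hc0
      rw [pow_sub_one_mul hq0, hc, one_mul]
    refine orderOf_dvd_of_pow_eq_one (D.eq_one_of_vec hx hy hxy ?_ ?_
      (plane_of_line D.b_ne hx hv) hv0 (by rw [hpow, hc1, one_mul]))
    · exact_mod_cast hfix hσx (q - 1 : ℕ)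
    · exact_mod_cast hfix hσy (q - 1 : ℕ)
  · intro z hz hσz
    exact ncard_sigmaOrbit fun k hk => D.eq_one_of_three hx hy hz hxy
      (by rintro rfl; exact hσz hσx) (by rintro rfl; exact hσz hσy) (hfix hσx k) (hfix hσy k) hk
  · intro e he
    refine ncard_sigmaOrbit fun k hk => ?_
    have hE := trace_mem_minusPoints D.q_eq he
    have hr := chord_mem D.q_eq hx hy hxy
    -- The fixed vector is `trace n e + 1 / (x + y)`; it is nonzero because `Q` is 0 at the first
    -- point and 1 at the second.
    refine D.eq_one_of_vec hx hy hxy (hfix hσx k) (hfix hσy k)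
      (affine_add_affine D.q_eq hE.1 (affine_of_chord D.q_eq D.b_ne hx hr))
      (D.minus_add_chord_ne_zero hE hx hr) ?_
    rw [map_add, map_trace, hk, map_div₀, map_one, map_add, hfix hσx, hfix hσy]

theorem unipotent_of_one_fixed {σ : L ≃ₐ[E] L} {x v r : L} (hx : x ∈ trinomialRoots q b)
    (hσx : σ x = x) (huniq : ∀ y ∈ trinomialRoots q b, σ y = y → y = x)
    (hv : v ∈ lineOf q b x) (hv0 : v ≠ 0) (hr : r ∈ chordsAt q b x) :
    σ v = v ∧ ∃ d, d ^ q = d ∧ d ≠ 0 ∧ σ r = r + d * v := by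
  have hno : ∀ r ∈ chordsAt q b x, σ r ≠ r := fun r hr h => by
    obtain ⟨-, h1, h2⟩ := root_of_chord D.q_eq hx (root_ne_zero D.b_ne hx) hr
    exact h2 (huniq _ h1 (by simp [hσx, h]))
  have hc := lineOf_div D.b_ne hv hv0 (hσx ▸ D.map_line σ hv)
  have hσv : σ v = (σ v / v) * v := by field_simp
  set c := σ v / v
  have hd := lineOf_div D.b_ne hv hv0 (chord_add_chord D.q_eq (hσx ▸ D.map_chord σ hr) hr)
  have hσr : σ r = r + ((σ r + r) / v) * v := by field_simp; grind
  set d := (σ r + r) / v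
  refine ⟨?_, d, hd, fun h => hno r hr (by rw [hσr, h]; ring), hσr⟩
  by_contra hcv
  have hc1 : c + 1 ≠ 0 := fun h => hcv (by rw [hσv]; grind)
  have hs : (d / (c + 1)) ^ q = d / (c + 1) := by
    rw [div_pow, add_pow_q D.q_eq, hd, hc, one_pow]
  have hs2 : d / (c + 1) * (c + 1) = d := div_mul_cancel₀ _ hc1
  -- If the eigenvalue `c` were not 1, the affine map `σ` on the chords at `x` would have the fixed
  -- point `r + s v`, and hence `σ` a second fixed root.
  generalize d / (c + 1) = s at hs hs2
  refine hno _ (chord_add_line D.q_eq hr (lineOf_smul hs hv)) ?_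
  rw [map_add, map_mul, D.map_fixedByPow σ s hs, hσr, hσv]
  grind

theorem sq_eq_one_of_one_fixed {σ : L ≃ₐ[E] L} {x : L} (hx : x ∈ trinomialRoots q b)
    (hσx : σ x = x) (huniq : ∀ y ∈ trinomialRoots q b, σ y = y → y = x) : σ ^ 2 = 1 := by
  obtain ⟨v, hv, hv0⟩ := exists_mem_lineOf D.n_ne D.q_eq D.ncard_roots hx
  obtain ⟨r, hr⟩ := exists_chord D.n_ne D.q_eq D.ncard_roots hx
  obtain ⟨hσv, d, hd, -, hσr⟩ := D.unipotent_of_one_fixed hx hσx huniq hv hv0 hr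
  refine D.eq_one_of_chord hx ?_ hv hv0 ?_ hr ?_
  · rw [pow_two, AlgEquiv.mul_apply, hσx, hσx]
  · rw [pow_two, AlgEquiv.mul_apply, hσv, hσv]
  · rw [pow_two, AlgEquiv.mul_apply, hσr, map_add, map_mul, hσv, D.map_fixedByPow σ d hd, hσr]
    grind

theorem ncard_fixed_of_one_fixed {σ : L ≃ₐ[E] L} {x : L} (hx : x ∈ trinomialRoots q b)
    (hσx : σ x = x) (huniq : ∀ y ∈ trinomialRoots q b, σ y = y → y = x) :
    {A | A ∈ minusPoints n q b ∧ σ A = A}.ncard = q / 2 := by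
  have hq := D.q_eq
  have hb := D.b_ne
  obtain ⟨y, hy, hyx⟩ := exists_ne_root D.n_ne hq D.ncard_roots x
  obtain ⟨v, hv, hv0⟩ := exists_mem_lineOf D.n_ne hq D.ncard_roots hx
  obtain ⟨w, hw, hw0⟩ := exists_mem_lineOf D.n_ne hq D.ncard_roots hy
  obtain ⟨r, hr⟩ := exists_chord D.n_ne hq D.ncard_roots hx
  obtain ⟨hσv, d, hd, hd0, hσr⟩ := D.unipotent_of_one_fixed hx hσx huniq hv hv0 hr
  have hk : coordLin q b x v w ≠ 0 := coordLin_ne_zero hyx.symm hv0 hw hw0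
  have hwp := plane_of_line hb hy hw
  have hkq := coordLin_mem hq hb hx hv hwp
  have hσk := D.map_fixedByPow σ _ hkq
  rw [D.map_coordLin, hσx, hσv] at hσk
  -- Determinant 1: `σ` fixes `v` and preserves the form, so `w` moves only along `v`.
  have hline : σ w + w ∈ lineOf q b x := by
    rw [← coordLin_eq_zero hv0, coordLin_add hq, hσk, CharTwo.add_self_eq_zero]
  have hα := lineOf_div hb hv hv0 hline
  have hσw : σ w = w + ((σ w + w) / v) * v := by field_simp; grind
  set α := (σ w + w) / v
  have hα0 : α ≠ 0 := fun h => by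
    rw [h, zero_mul, add_zero] at hσw
    exact hyx (huniq y hy (line_unique hw0 (hσw ▸ D.map_line σ hw) hw))
  have ht : (d / α) ^ q = d / α := by rw [div_pow, hd, hα]
  have ht0 : d / α ≠ 0 := div_ne_zero hd0 hα0
  -- As `σ` moves `r + t w + s v` by `(d + t α) v`, its fixed points form the parallel `t = d / α`.
  -- Here `t ≠ 0`, so half of them are in `minusPoints`.
  have htα : d / α * α = d := div_mul_cancel₀ _ hα0
  have htu : ∀ t : L, t * α = d → t = d / α := fun t h => by rw [← h]; field_simp
  generalize d / α = t at ht ht0 htα htu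
  set A := r + t * w with hA
  have hAm : A ∈ affinePlane q b :=
    affine_add_plane hq (affine_of_chord hq hb hx hr) (plane_of_line hb hy (lineOf_smul ht hw))
  have hAc : coord q b x v A = t * coordLin q b x v w := coord_add_smul hq hr ht
  have hσA : σ A = A := by
    rw [hA, map_add, map_mul, D.map_fixedByPow σ t ht, hσr, hσw]
    grind
  rw [← ncard_minus_coset D.n_ne hq hb (ncard_fixedByPow D.n_ne hq hb D.ncard_roots) hx hv hAm
    (by rw [hAc]; exact mul_ne_zero ht0 hk) (by rw [hAc, mul_pow, hkq, ht]),
    ← Set.ncard_image_of_injective (f := fun s => A + s * v)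
      {s : L | s ^ q = s ∧ A + s * v ∈ minusPoints n q b}
      ((add_right_injective A).comp (mul_left_injective₀ hv0))]
  congr 1
  ext B
  constructor
  · rintro ⟨hB, hσB⟩
    have hBr := affine_add_affine hq hB.1 (affine_of_chord hq hb hx hr)
    have hcq := coordLin_mem hq hb hx hv hBr
    set t' := coordLin q b x v (B + r) / coordLin q b x v w with ht'
    have htq : t' ^ q = t' := by rw [ht', div_pow, hcq, hkq]
    have hl : B + r + t' * w ∈ lineOf q b x := by
      rw [← coordLin_eq_zero hv0, coordLin_add hq, coordLin_smul _ _ _ htq, ht',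
        div_mul_cancel₀ _ hk, CharTwo.add_self_eq_zero]
    have hs := lineOf_div hb hv hv0 hl
    have hBs : B = r + t' * w + (B + r + t' * w) / v * v := by field_simp; grind
    set s := (B + r + t' * w) / v
    have e : σ B = B + (d + t' * α) * v := by
      rw [hBs, map_add, map_add, map_mul, map_mul, D.map_fixedByPow σ s hs,
        D.map_fixedByPow σ t' htq, hσr, hσw, hσv]
      ring
    rw [hσB, left_eq_add, mul_eq_zero, or_iff_left hv0] at e
    have htt : t' = t := by
      rw [htu t]
      · exact htu t' (by grind)
      · exact htα
    refine ⟨s, ⟨hs, ?_⟩, ?_⟩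
    · rw [hA, ← htt, ← hBs]
      exact hB
    · change A + s * v = B
      rw [hA, ← htt, ← hBs]
  · rintro ⟨s, ⟨hs, hs'⟩, rfl⟩
    exact ⟨hs', by simp only [map_add, map_mul, hσA, hσv, D.map_fixedByPow σ s hs]⟩

/-- If `σ` swaps two lines then `σ² v = c v`. Invariance of the form, which is symmetric in
characteristic 2, forces `c = 1`, so `v + σ v` is a fixed vector. -/
theorem exists_fixed_of_swap {σ : L ≃ₐ[E] L} {x : L} (hx : x ∈ trinomialRoots q b)
    (hσx : σ (σ x) = x) : ∃ y ∈ trinomialRoots q b, σ y = y := by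
  by_cases hne : σ x = x
  · exact ⟨x, hx, hne⟩
  have hq := D.q_eq
  have hb := D.b_ne
  obtain ⟨v, hv, hv0⟩ := exists_mem_lineOf D.n_ne hq D.ncard_roots hx
  have hv1 := D.map_line σ hv
  have hv2 := D.map_line σ hv1
  rw [hσx] at hv2
  have hc := lineOf_div hb hv hv0 hv2
  have hσσ : σ (σ v) = σ (σ v) / v * v := by field_simp
  generalize σ (σ v) / v = c at hc hσσ
  have hp := plane_of_line hb hx hv
  have hp1 := D.map_plane σ hp
  have hω : (coordLin q b x v (σ v)) ^ q = coordLin q b x v (σ v) := coordLin_mem hq hb hx hv hp1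
  have hω0 : coordLin q b x v (σ v) ≠ 0 :=
    coordLin_ne_zero (Ne.symm hne) hv0 hv1 (by simpa using hv0)
  have hsym : coordLin q b (σ x) (σ v) v = coordLin q b x v (σ v) := by
    simp only [lineOf, coordLin, Set.mem_ofPred_eq] at *
    grind
  have h := D.map_fixedByPow σ _ hω
  rw [D.map_coordLin, hσσ, coordLin_smul _ _ _ hc, hsym] at h
  have hc1 : c = 1 := by
    apply mul_right_cancel₀ hω0
    rw [h, one_mul]
  rw [hc1, one_mul] at hσσ
  refine D.exists_fixed_root_of_vec (plane_add hq hp hp1) ?_ (by rw [map_add, hσσ, add_comm])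
  intro h0
  have : σ v = v := by grind
  exact hne (line_unique hv0 (this ▸ hv1) hv)

theorem orbits_of_no_fixed {σ : L ≃ₐ[E] L} (hσ : ∀ x ∈ trinomialRoots q b, σ x ≠ x)
    (hcard : (mcmRoots n q b).ncard = (q - 1) * (q / 2)) :
    orderOf σ ∣ q + 1 ∧
    (∀ z ∈ trinomialRoots q b, (sigmaOrbit σ z).ncard = orderOf σ) ∧
    {e | e ∈ mcmRoots n q b ∧ σ e = e}.ncard = 1 ∧
    (∀ e ∈ mcmRoots n q b, σ e ≠ e → (sigmaOrbit σ e).ncard = orderOf σ) := by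
  have hq := D.q_eq
  -- A power fixing `x` also fixes `σ x` and `σ² x`; the three are distinct because `σ` swaps no two
  -- roots.
  have hfree : ∀ k : ℤ, ∀ x ∈ trinomialRoots q b, (σ ^ k) x = x → σ ^ k = 1 := by
    intro k x hx hk
    have h1 := D.map_root σ hx
    have h2 := D.map_root σ h1
    have hk1 : (σ ^ k) (σ x) = σ x := by rw [zpow_apply_comm, hk]
    refine D.eq_one_of_three hx h1 h2 (hσ x hx).symm ?_ (hσ _ h1).symm hk hk1
      (by rw [zpow_apply_comm, hk1])
    intro h
    obtain ⟨y, hy, hσy⟩ := D.exists_fixed_of_swap hx h.symm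
    exact hσ y hy hσy
  have huniq : ∀ k : ℤ, ∀ A ∈ minusPoints n q b, ∀ B ∈ minusPoints n q b, A ≠ B →
      (σ ^ k) A = A → (σ ^ k) B = B → σ ^ k = 1 := by
    intro k A hA B hB hAB hkA hkB
    obtain ⟨x, hx, hkx⟩ := D.exists_fixed_root_of_vec (σ := σ ^ k)
      (affine_add_affine hq hA.1 hB.1) (by grind) (by rw [map_add, hkA, hkB])
    exact hfree k x hx hkx
  have horb : ∀ z ∈ trinomialRoots q b, (sigmaOrbit σ z).ncard = orderOf σ := fun z hz =>
    ncard_sigmaOrbit fun k => hfree k z hz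
  have horbe : ∀ e ∈ mcmRoots n q b, σ e ≠ e → (sigmaOrbit σ e).ncard = orderOf σ := by
    intro e he hσe
    refine ncard_sigmaOrbit fun k hk => ?_
    have hA := trace_mem_minusPoints hq he
    have hB := trace_mem_minusPoints hq (D.map_mcmRoot σ he)
    have hkA : (σ ^ k) (trace n e) = trace n e := by rw [map_trace, hk]
    have hkB : (σ ^ k) (trace n (σ e)) = trace n (σ e) := by
      rw [map_trace, zpow_apply_comm, hk]
    refine huniq k _ hA _ hB (fun h => hσe ?_) hkA hkB
    have h' := congrArg (point q b) h
    rw [point_trace hq he, point_trace hq (D.map_mcmRoot σ he)] at h'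
    exact h'.symm
  have hdvd : orderOf σ ∣ q + 1 := by
    rw [← D.ncard_roots, ncard_eq_mul_ncard_orbits D.finite_roots
      (fun k x hx => D.map_root _ hx) horb]
    exact dvd_mul_right _ _
  refine ⟨hdvd, horb, ?_, horbe⟩
  have hle : ∀ e ∈ mcmRoots n q b, σ e = e → ∀ f ∈ mcmRoots n q b, σ f = f → e = f := by
    intro e he hσe f hf hσf
    by_contra hef
    obtain ⟨x, hx, -⟩ := exists_ne_root D.n_ne hq D.ncard_roots 0
    have h1 : σ ^ (1 : ℤ) = 1 := by
      refine huniq 1 _ (trace_mem_minusPoints hq he) _ (trace_mem_minusPoints hq hf) (fun h => ?_)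
        (by rw [zpow_one, map_trace, hσe]) (by rw [zpow_one, map_trace, hσf])
      exact hef (by rw [← point_trace hq he, h, point_trace hq hf])
    rw [zpow_one] at h1
    exact hσ x hx (by rw [h1]; rfl)
  have hex : ∃ e ∈ mcmRoots n q b, σ e = e := by
    by_contra! hne
    have hd : orderOf σ ∣ (q - 1) * (q / 2) := by
      rw [← hcard, ncard_eq_mul_ncard_orbits D.finite_mcmRoots
        (fun k x hx => D.map_mcmRoot _ hx) (fun e he => horbe e he (hne e he))]
      exact dvd_mul_right _ _
    obtain ⟨m, hm⟩ : ∃ m, q = 2 * m := by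
      obtain ⟨m, hm⟩ := Nat.exists_eq_succ_of_ne_zero D.n_ne
      exact ⟨2 ^ m, by rw [hq, hm, pow_succ, mul_comm]⟩
    have hm1 : 1 ≤ m := by
      have : 0 < q := by rw [hq]; positivity
      omega
    -- Without a fixed root of `C(x) + a`, the order of `σ` would divide both of these coprime
    -- numbers, making `σ` trivial.
    have hcop : Nat.Coprime (q + 1) ((q - 1) * (q / 2)) := by
      have hc1 : Nat.Coprime (q + 1) q := by simp
      apply Nat.Coprime.mul_right
      · have h2 : Nat.Coprime (q + 1) 2 := hc1.coprime_dvd_right ⟨m, hm⟩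
        have e : q + 1 = (q - 1) + 2 := by omega
        rw [e] at h2 ⊢
        rw [Nat.coprime_add_self_left] at h2
        rw [Nat.coprime_self_add_left]
        exact h2.symm
      · exact hc1.coprime_dvd_right ⟨2, by omega⟩
    have h1 := Nat.eq_one_of_dvd_coprimes hcop hdvd hd
    rw [orderOf_eq_one_iff] at h1
    obtain ⟨x, hx, -⟩ := exists_ne_root D.n_ne hq D.ncard_roots 0
    exact hσ x hx (by rw [h1]; rfl)
  obtain ⟨e, he, hσe⟩ := hex
  rw [Set.ncard_eq_one]
  refine ⟨e, Set.eq_singleton_iff_unique_mem.2 ⟨⟨he, hσe⟩, fun f hf => ?_⟩⟩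
  exact hle f hf.1 hf.2 e he hσe

end RootExtension

end MCM

namespace MCM

/-- A parallel with nonzero coordinate carries `q / 2` such points, and `n ≥ 2` makes this at least
two. Their difference lets `x` be recovered from roots of `C(x) + a`. -/
theorem exists_minus_pair {L : Type*} [Field L] [CharP L 2] {n q : ℕ} {b : L} (hn : 2 ≤ n)
    (hq : q = 2 ^ n) (hb : b ≠ 0) (hR : (trinomialRoots q b).ncard = q + 1) {x : L}
    (hx : x ∈ trinomialRoots q b) :
    ∃ A ∈ minusPoints n q b, ∃ B ∈ minusPoints n q b, A + B ≠ 0 ∧ A + B ∈ lineOf q b x := by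
  have hn0 : n ≠ 0 := by omega
  obtain ⟨y, hy, hyx⟩ := exists_ne_root hn0 hq hR x
  obtain ⟨v, hv, hv0⟩ := exists_mem_lineOf hn0 hq hR hx
  obtain ⟨w, hw, hw0⟩ := exists_mem_lineOf hn0 hq hR hy
  obtain ⟨r, hr⟩ := exists_chord hn0 hq hR hx
  have hk : coordLin q b x v w ≠ 0 := coordLin_ne_zero hyx.symm hv0 hw hw0
  have hwp := plane_of_line hb hy hw
  have hc := coord_add_smul (v := v) (w := w) hq hr (one_pow q)
  rw [one_mul, one_mul] at hc
  have hcard := ncard_minus_coset hn0 hq hb (ncard_fixedByPow hn0 hq hb hR) hx hv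
    (affine_add_plane hq (affine_of_chord hq hb hx hr) hwp) (by rwa [hc])
    (by rw [hc, coordLin_mem hq hb hx hv hwp])
  have h2 : 1 < q / 2 := by
    obtain ⟨m, rfl⟩ := Nat.exists_eq_add_of_le hn
    have : 0 < 2 ^ m := Nat.two_pow_pos m
    rw [hq, pow_add]
    omega
  rw [← hcard] at h2
  obtain ⟨s, hs, s', hs', hne⟩ :=
    (Set.one_lt_ncard (Set.finite_of_ncard_ne_zero (by omega))).1 h2
  have e : r + w + s * v + (r + w + s' * v) = (s + s') * v := by grind
  refine ⟨_, hs.2, _, hs'.2, ?_, ?_⟩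
  · rw [e]
    exact mul_ne_zero (by grind) hv0
  · rw [e]
    exact lineOf_smul (by rw [add_pow_q hq, hs.1, hs'.1]) hv

/-! ### Degrees, separability and splitting fields of the two polynomials. -/

section Polynomials

variable {F : Type*} [Field F]

theorem natDegree_trinomial {n : ℕ} (a : F) : (trinomial n a).natDegree = 2 ^ n + 1 := by
  have h : (X + C (1 / a) : F[X]).degree < (X ^ (2 ^ n + 1) : F[X]).degree := by
    rw [degree_X_add_C, degree_X_pow]
    exact_mod_cast Nat.lt_add_of_pos_left (Nat.two_pow_pos n)
  rw [trinomial, add_assoc, natDegree_add_eq_left_of_degree_lt h, natDegree_X_pow]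

theorem trinomial_ne_zero {n : ℕ} (a : F) : trinomial n a ≠ 0 := fun h => by
  have := natDegree_trinomial (n := n) a
  simp [h] at this

theorem separable_trinomial [CharP F 2] {n : ℕ} (hn : n ≠ 0) {a : F} (ha : a ≠ 0) :
    (trinomial n a).Separable := by
  have h2 : (2 : F) = 0 := CharTwo.two_eq_zero
  have hd : derivative (trinomial n a) = X ^ 2 ^ n + 1 := by
    simp [trinomial, h2, hn]
  refine ⟨C a, -(C a * X), ?_⟩
  have h1 : C a * C (1 / a) = (1 : F[X]) := by
    rw [← C_mul, mul_one_div_cancel ha, C_1]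
  rw [hd, trinomial]
  linear_combination h1

theorem natDegree_mcmAdd {n : ℕ} (hn : n ≠ 0) (a : F) :
    (mcmAdd n a).natDegree = (2 ^ n - 1) * (2 ^ n / 2) := by
  obtain ⟨m, rfl⟩ := Nat.exists_eq_succ_of_ne_zero hn
  have hdeg : (∑ i ∈ Finset.range m, (X : F[X]) ^ (2 ^ i - 1)).degree < (2 ^ m - 1 : ℕ) := by
    rw [← mem_degreeLT]
    refine sum_mem fun i hi => ?_
    rw [mem_degreeLT, degree_X_pow]
    have h1 := Nat.pow_lt_pow_right one_lt_two (Finset.mem_range.1 hi)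
    have h2 := Nat.two_pow_pos i
    exact_mod_cast (by omega : 2 ^ i - 1 < 2 ^ m - 1)
  have hT : T F (m + 1) = X ^ (2 ^ m - 1) + ∑ i ∈ Finset.range m, (X : F[X]) ^ (2 ^ i - 1) := by
    rw [T, Finset.sum_range_succ, add_comm]
  have hm : (T F (m + 1)).Monic := hT ▸ monic_X_pow_add hdeg
  have hTd : (T F (m + 1)).natDegree = 2 ^ m - 1 := by
    rw [hT, natDegree_add_eq_left_of_degree_lt (by rwa [degree_X_pow]), natDegree_X_pow]
  rw [mcmAdd, natDegree_add_C, mcm, monic_X.natDegree_mul (hm.pow _), hm.natDegree_pow, hTd,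
    natDegree_X]
  obtain ⟨k, hk⟩ := Nat.exists_eq_succ_of_ne_zero (Nat.two_pow_pos m).ne'
  have e1 : 2 ^ (m + 1) = 2 * (k + 1) := by rw [pow_succ, hk, Nat.succ_eq_add_one]; ring
  have e2 : 2 * (k + 1) - 1 = 2 * k + 1 := by omega
  rw [Nat.succ_eq_add_one, e1, hk, e2, Nat.mul_div_cancel_left _ two_pos, Nat.succ_sub_one]
  ring

theorem mcmAdd_ne_zero {n : ℕ} (hn : n ≠ 0) (a : F) : mcmAdd n a ≠ 0 := fun h => by
  have := natDegree_mcmAdd hn a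
  obtain ⟨m, rfl⟩ := Nat.exists_eq_succ_of_ne_zero hn
  rw [h, natDegree_zero, pow_succ, Nat.mul_div_cancel _ two_pos] at this
  have h2 := Nat.two_pow_pos m
  exact (Nat.mul_pos (by omega : 0 < 2 ^ m * 2 - 1) h2).ne this

variable {L : Type*} [Field L] [Algebra F L]

theorem aeval_T (n : ℕ) (e : L) : e * aeval e (T F n) = trace n e := by
  simp only [T, trace, map_sum, map_pow, aeval_X, Finset.mul_sum]
  refine Finset.sum_congr rfl fun i _ => ?_
  rw [mul_pow_sub_one (Nat.two_pow_pos i).ne']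

theorem ncard_rootSet_trinomial [CharP F 2] {n : ℕ} (hn : n ≠ 0) {a : F} (ha : a ≠ 0)
    [IsSplittingField F L (trinomial n a)] :
    ((trinomial n a).rootSet L).ncard = 2 ^ n + 1 := by
  classical
  rw [← natDegree_trinomial (n := n) a, ← card_rootSet_eq_natDegree (separable_trinomial hn ha)
    (IsSplittingField.splits L (trinomial n a)), ← Nat.card_eq_fintype_card,
    Nat.card_coe_set_eq]

variable [CharP L 2]

theorem rootSet_trinomial {n q : ℕ} (hq : q = 2 ^ n) (a : F) :
    (trinomial n a).rootSet L = trinomialRoots q (algebraMap F L (1 / a)) := by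
  ext x
  rw [mem_rootSet_of_ne (trinomial_ne_zero a)]
  simp only [trinomial, trinomialRoots, map_add, map_pow, aeval_X, aeval_C, ← hq,
    Set.mem_ofPred_eq]
  constructor <;> intro h <;> grind

theorem rootSet_mcmAdd {n q : ℕ} (hn : n ≠ 0) (hq : q = 2 ^ n) {a : F} (ha : a ≠ 0) :
    (mcmAdd n a).rootSet L = mcmRoots n q (algebraMap F L (1 / a)) := by
  have ha' : algebraMap F L a ≠ 0 := by simpa using ha
  ext e
  rw [mem_rootSet_of_ne (mcmAdd_ne_zero hn a)]
  simp only [mcmAdd, mcm, mcmRoots, map_add, map_mul, map_pow, aeval_X, aeval_C, ← hq,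
    Set.mem_ofPred_eq, ← aeval_T (F := F) n e, map_div₀, map_one]
  generalize aeval e (T F n) = t
  generalize algebraMap F L a = c at *
  have h1 : 1 / c * c = 1 := by field_simp
  generalize 1 / c = d at *
  simp only [mul_pow]
  constructor
  · intro h
    refine ⟨by rintro rfl; simp [ha'] at h, ?_⟩
    grind
  · rintro ⟨he, h⟩
    have heq := pow_ne_zero q he
    -- The equation defining `mcmRoots` is `C(e) = a` multiplied by `b e^q`, hence the condition `e
    -- ≠ 0` there.
    have : e ^ q * (d * (e * t ^ (q + 1))) = e ^ q * 1 := by linear_combination h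
    have := mul_left_cancel₀ heq this
    grind

theorem ncard_mcmRoots_eq {n q : ℕ} (hn : n ≠ 0) (hq : q = 2 ^ n) {a : F} (ha : a ≠ 0)
    (hR : (trinomialRoots q (algebraMap F L (1 / a))).ncard = q + 1) :
    (mcmRoots n q (algebraMap F L (1 / a))).ncard = (q - 1) * (q / 2) := by
  have hb : algebraMap F L (1 / a) ≠ 0 := by simpa using ha
  refine le_antisymm ?_ (by
    rw [ncard_mcmRoots hq hb]; exact le_ncard_minusPoints hn hq hb hR)
  rw [← rootSet_mcmAdd hn hq ha]
  have h := (finite_and_ncard_le_natDegree (p := (mcmAdd n a).map (algebraMap F L))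
    (A := (mcmAdd n a).rootSet L) (Polynomial.map_ne_zero (mcmAdd_ne_zero hn a)) fun x hx => by
      rw [eval_map_algebraMap]
      exact aeval_eq_zero_of_mem_rootSet hx).2
  rwa [natDegree_map, natDegree_mcmAdd hn, ← hq] at h

theorem isSplittingField_mcmAdd [CharP F 2] {n : ℕ} (hn : 2 ≤ n) {a : F} (ha : a ≠ 0)
    [IsSplittingField F L (trinomial n a)] : IsSplittingField F L (mcmAdd n a) := by
  classical
  have hn0 : n ≠ 0 := by omega
  obtain ⟨q, hq⟩ : ∃ q, q = 2 ^ n := ⟨_, rfl⟩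
  have hb : algebraMap F L (1 / a) ≠ 0 := by simpa using ha
  have hR : (trinomialRoots q (algebraMap F L (1 / a))).ncard = q + 1 := by
    rw [← rootSet_trinomial hq, ncard_rootSet_trinomial hn0 ha, hq]
  have hM := ncard_mcmRoots_eq hn0 hq ha hR
  have htop := (isSplittingField_iff_intermediateField.1
    (inferInstance : IsSplittingField F L (trinomial n a))).2
  rw [isSplittingField_iff_intermediateField]
  constructor
  · rw [splits_iff_card_roots]
    refine le_antisymm (card_roots' _) ?_
    rw [natDegree_map, natDegree_mcmAdd hn0, ← hq, ← hM, ← rootSet_mcmAdd hn0 hq ha, rootSet,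
      Set.ncard_coe_finset]
    exact Multiset.toFinset_card_le _
  · rw [rootSet_mcmAdd hn0 hq ha]
    set K := IntermediateField.adjoin F (mcmRoots n q (algebraMap F L (1 / a))) with hK
    rw [eq_top_iff, ← htop, IntermediateField.adjoin_le_iff, rootSet_trinomial hq]
    have hbK : algebraMap F L (1 / a) ∈ K := K.algebraMap_mem _
    have hminus : ∀ A ∈ minusPoints n q (algebraMap F L (1 / a)), A ∈ K := fun A hA => by
      have hp : point q (algebraMap F L (1 / a)) A ∈ K :=
        IntermediateField.subset_adjoin _ _ (point_mem_mcmRoots hq hb hA)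
      rw [← hA.2]
      exact sum_mem fun i _ => pow_mem hp _
    intro x hx
    obtain ⟨A, hA, B, hB, h0, hl⟩ := exists_minus_pair hn hq hb hR hx
    have hu : A + B ∈ K := add_mem (hminus A hA) (hminus B hB)
    generalize A + B = u at *
    generalize algebraMap F L (1 / a) = b at *
    -- A nonzero vector `u` of the line gives `x² = b u^q / u`; since `q` is even, `x^q` follows,
    -- and the trinomial equation then gives `x` rationally.
    have hx2 : x ^ 2 ∈ K := by
      have : x ^ 2 = b * u ^ q / u := by
        rw [eq_div_iff h0]
        exact hl.symm
      rw [this]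
      exact div_mem (mul_mem hbK (pow_mem hu _)) hu
    have hxq : x ^ q ∈ K := by
      obtain ⟨m, rfl⟩ := Nat.exists_eq_succ_of_ne_zero hn0
      rw [hq, pow_succ', pow_mul]
      exact pow_mem hx2 _
    have hx1 : x ^ q * x = x + b := hx
    have hne : x ^ q + 1 ≠ 0 := fun h => hb (by grind)
    have : x = b / (x ^ q + 1) := by
      rw [eq_div_iff hne]
      grind
    rw [SetLike.mem_coe, this]
    exact div_mem hbK (add_mem hxq (one_mem K))

theorem rootExtension_compositum [CharP F 2] {n q : ℕ} (hn : n ≠ 0) (hq : q = 2 ^ n) {a : F}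
    (ha : a ≠ 0) [IsSplittingField F L (trinomial n a)] :
    RootExtension (compositum F L q) n q (algebraMap F L (1 / a)) where
  n_ne := hn
  q_eq := hq
  b_ne := by simpa using ha
  ncard_roots := by rw [← rootSet_trinomial hq, ncard_rootSet_trinomial hn ha, hq]
  map_b σ := by
    rw [IsScalarTower.algebraMap_apply F (compositum F L q) L]
    exact σ.commutes _
  map_fixedByPow σ t ht :=
    σ.commutes (⟨t, IntermediateField.subset_adjoin _ _ ht⟩ : compositum F L q)
  eq_one σ h := by
    rw [← rootSet_trinomial hq] at h
    have := AlgHom.ext_of_adjoin_eq_top (IsSplittingField.adjoin_rootSet L (trinomial n a))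
      (φ₁ := ((σ.restrictScalars F : L ≃ₐ[F] L) : L →ₐ[F] L)) (φ₂ := AlgHom.id F L) h
    ext x
    exact DFunLike.congr_fun this x

end Polynomials

end MCM

/-! ### The main theorem. -/

theorem theorem6p2 {F : Type*} [Field F] [CharP F 2] (n : ℕ) (hn : 2 ≤ n) (q : ℕ) (hq : q = 2 ^ n)
    (a : F) (ha : a ≠ 0) {L : Type*} [Field L] [Algebra F L]
    [Polynomial.IsSplittingField F L (MCM.trinomial n a)] :
    -- `L` is also the splitting field of `C(x) + a`, and it contains the field with `q` elements
    Polynomial.IsSplittingField F L (MCM.mcmAdd n a) ∧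
    (MCM.fixedByPow L q).ncard = q ∧
    ∀ σ : L ≃ₐ[MCM.compositum F L q] L,
      -- at least three fixed roots
      (3 ≤ (MCM.fixedRoots σ (MCM.trinomial n a)).ncard →
        (∀ x ∈ (MCM.trinomial n a).rootSet L, σ x = x) ∧
        (∀ e ∈ (MCM.mcmAdd n a).rootSet L, σ e = e)) ∧
      -- exactly two fixed roots
      ((MCM.fixedRoots σ (MCM.trinomial n a)).ncard = 2 →
        ∃ δ : ℕ, δ ∣ q - 1 ∧
          (∀ x ∈ (MCM.trinomial n a).rootSet L, σ x ≠ x → (MCM.sigmaOrbit σ x).ncard = δ) ∧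
          (∀ e ∈ (MCM.mcmAdd n a).rootSet L, (MCM.sigmaOrbit σ e).ncard = δ)) ∧
      -- exactly one fixed root
      ((MCM.fixedRoots σ (MCM.trinomial n a)).ncard = 1 →
        (∀ x ∈ (MCM.trinomial n a).rootSet L, σ x ≠ x → (MCM.sigmaOrbit σ x).ncard = 2) ∧
        (MCM.fixedRoots σ (MCM.mcmAdd n a)).ncard = q / 2 ∧
        (∀ e ∈ (MCM.mcmAdd n a).rootSet L, σ e ≠ e → (MCM.sigmaOrbit σ e).ncard = 2) ∧
        {O : Set L | ∃ e ∈ (MCM.mcmAdd n a).rootSet L, σ e ≠ e ∧ O = MCM.sigmaOrbit σ e}.ncard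
          = q / 2 * (q / 2 - 1)) ∧
      -- no fixed root
      ((MCM.fixedRoots σ (MCM.trinomial n a)).ncard = 0 →
        ∃ δ : ℕ, δ ∣ q + 1 ∧
          (∀ x ∈ (MCM.trinomial n a).rootSet L, (MCM.sigmaOrbit σ x).ncard = δ) ∧
          (MCM.fixedRoots σ (MCM.mcmAdd n a)).ncard = 1 ∧
          (∀ e ∈ (MCM.mcmAdd n a).rootSet L, σ e ≠ e → (MCM.sigmaOrbit σ e).ncard = δ)) := by
  have hn0 : n ≠ 0 := by omega
  have : CharP L 2 := charP_of_injective_algebraMap (algebraMap F L).injective 2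
  have D := MCM.rootExtension_compositum (L := L) hn0 hq ha
  have hM := MCM.ncard_mcmRoots_eq hn0 hq ha D.ncard_roots
  refine ⟨MCM.isSplittingField_mcmAdd hn ha,
    MCM.ncard_fixedByPow hn0 hq D.b_ne D.ncard_roots, fun σ => ?_⟩
  simp only [MCM.fixedRoots, MCM.rootSet_trinomial (L := L) hq a,
    MCM.rootSet_mcmAdd (L := L) hn0 hq ha]
  generalize algebraMap F L (1 / a) = b at D hM ⊢
  have hfin : {x | x ∈ MCM.trinomialRoots q b ∧ σ x = x}.Finite :=
    D.finite_roots.subset fun x hx => hx.1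
  refine ⟨fun h => ?_, fun h => ?_, fun h => ?_, fun h => ?_⟩
  · obtain ⟨x, y, z, hx, hy, hz, hxy, hxz, hyz⟩ := (Set.two_lt_ncard_iff hfin).1 h
    rw [D.eq_one_of_three hx.1 hy.1 hz.1 hxy hxz hyz hx.2 hy.2 hz.2]
    exact ⟨fun _ _ => rfl, fun _ _ => rfl⟩
  · obtain ⟨x, y, hxy, hset⟩ := Set.ncard_eq_two.1 h
    have hx : x ∈ ({x, y} : Set L) := by simp
    have hy : y ∈ ({x, y} : Set L) := by simp
    rw [← hset] at hx hy
    exact ⟨_, D.orbits_of_two_fixed hx.1 hy.1 hxy hx.2 hy.2⟩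
  · obtain ⟨x, hset⟩ := Set.ncard_eq_one.1 h
    obtain ⟨hx, huniq⟩ := Set.eq_singleton_iff_unique_mem.1 hset
    have h2 := D.sq_eq_one_of_one_fixed hx.1 hx.2 fun y hy hσy => huniq y ⟨hy, hσy⟩
    have hfix : {e | e ∈ MCM.mcmRoots n q b ∧ σ e = e}.ncard = q / 2 := by
      rw [D.ncard_fixed_mcmRoots,
        D.ncard_fixed_of_one_fixed hx.1 hx.2 fun y hy hσy => huniq y ⟨hy, hσy⟩]
    refine ⟨fun z _ hz => MCM.ncard_sigmaOrbit_eq_two h2 hz, hfix,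
      fun z _ hz => MCM.ncard_sigmaOrbit_eq_two h2 hz, ?_⟩
    have hsub : {e | e ∈ MCM.mcmRoots n q b ∧ σ e = e} ⊆ MCM.mcmRoots n q b := fun e he => he.1
    have hdiff := Set.ncard_sdiff_add_ncard_of_subset hsub D.finite_mcmRoots
    have horb := MCM.ncard_eq_mul_ncard_orbits (σ := σ) (d := 2)
      (X := MCM.mcmRoots n q b \ {e | e ∈ MCM.mcmRoots n q b ∧ σ e = e})
      (D.finite_mcmRoots.subset Set.sdiff_subset)
      (fun k e he => ⟨D.map_mcmRoot _ he.1, fun h => he.2 ⟨he.1, (σ ^ k).injective (by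
        rw [MCM.zpow_apply_comm, h.2])⟩⟩)
      (fun e he => MCM.ncard_sigmaOrbit_eq_two h2 fun h => he.2 ⟨he.1, h⟩)
    have hO : {O : Set L | ∃ e ∈ MCM.mcmRoots n q b \ {e | e ∈ MCM.mcmRoots n q b ∧ σ e = e},
        O = MCM.sigmaOrbit σ e} =
        {O : Set L | ∃ e ∈ MCM.mcmRoots n q b, σ e ≠ e ∧ O = MCM.sigmaOrbit σ e} := by
      ext O
      constructor
      · rintro ⟨e, he, rfl⟩
        exact ⟨e, he.1, fun h => he.2 ⟨he.1, h⟩, rfl⟩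
      · rintro ⟨e, he, hσe, rfl⟩
        exact ⟨e, ⟨he, fun h => hσe h.2⟩, rfl⟩
    rw [hfix, horb, hM, hO] at hdiff
    obtain ⟨k, hk⟩ : ∃ k, q = 2 * (k + 1) := by
      obtain ⟨m, rfl⟩ := Nat.exists_eq_succ_of_ne_zero hn0
      obtain ⟨k, hk⟩ := Nat.exists_eq_succ_of_ne_zero (Nat.two_pow_pos m).ne'
      exact ⟨k, by rw [hq, pow_succ, hk, mul_comm]⟩
    have e1 : q / 2 = k + 1 := by omega
    have e2 : q - 1 = 2 * k + 1 := by omega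
    rw [e1, e2] at hdiff
    rw [e1, Nat.add_sub_cancel]
    -- With `q = 2(k + 1)` and `N` orbits of size 2, `hdiff` reads `2N + (k + 1) = (2k + 1)(k + 1)`.
    nlinarith
  · rw [Set.ncard_eq_zero hfin] at h
    have hσ : ∀ x ∈ MCM.trinomialRoots q b, σ x ≠ x := fun x hx hσx => by
      have : x ∈ {x | x ∈ MCM.trinomialRoots q b ∧ σ x = x} := ⟨hx, hσx⟩
      rw [h] at this
      exact this
    exact ⟨_, D.orbits_of_no_fixed hσ hM⟩
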